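/- Let $n\ge 0$, and equip $\mathbb R^{n+1}$ with the quadratic form $Q(x)=x_0^2+\dots+x_{n-1}^2-x_n^2$. A vector $v$ is called space-like if $Q(v)>0$ and light-like if $Q(v)=0$. Let $\mathbf H^n=\{x\in\mathbb R^{n+1} : Q(x)=-1,\ x_n>0\}$ be the hyperboloid model of hyperbolic space; its conformal boundary is the set of lines spanned by nonzero light-like vectors. Let $SO_o(n,1)$ be the group of linear isometries of $(\mathbb R^{n+1},Q)$ of determinant $1$ that map $\mathbf H^n$ onto itself (this is the identity component of $SO(n,1)$). An element $T\in SO_o(n,1)$ is called real if there is $S\in SO_o(n,1)$ with $STS^{-1}=T^{-1}$, and hyperbolic if it has no fixed point in $\mathbf H^n$ and exactly two fixed points on the conformal boundary. Then: 1. Every element of $SO_o(n,1)$ is real if and only if $n\equiv 0 \pmod 4$ or $n\equiv 3\pmod 4$. 2. If $n\equiv 1\pmod 4$, then $T\in SO_o(n,1)$ is real if and only if either $T$ is hyperbolic and has at least one eigenvalue $1$ or $-1$, or $T$ is not hyperbolic. 3. If $n\equiv 2\pmod 4$, then $T\in SO_o(n,1)$ is real if and only if one of the following holds: (i) $T$ is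 hyperbolic; (ii) $T$ is not hyperbolic and has $-1$ as an eigenvalue; (iii) $T$ is not hyperbolic, $-1$ is not an eigenvalue of $T$, and $T$ has a space-like eigenvector with eigenvalue $1$. -/

import Mathlib

/-- An element of a group is real if it is conjugate, in that group, to its own inverse. -/
def IsRealElement {G : Type*} [Group G] (g : G) : Prop :=
  ∃ h : G, h * g * h⁻¹ = g⁻¹

/-- The quadratic form `x₀² + ⋯ + xₙ₋₁² - xₙ²` of signature `(n, 1)` on `ℝⁿ⁺¹`. -/
noncomputable def lorentzForm (n : ℕ) : QuadraticForm ℝ (Fin (n + 1) → ℝ) :=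
  QuadraticMap.weightedSumSquares ℝ (fun i => if i = Fin.last n then (-1 : ℝ) else 1)

theorem lorentzForm_apply (n : ℕ) (x : Fin (n + 1) → ℝ) :
    lorentzForm n x = ∑ i : Fin n, x i.castSucc ^ 2 - x (Fin.last n) ^ 2 := by
  simp [lorentzForm, QuadraticMap.weightedSumSquares_apply, Fin.sum_univ_castSucc,
    Fin.castSucc_ne_last, sq, sub_eq_add_neg]

/-- The hyperboloid model of hyperbolic `n`-space: the sheet of `Q = -1` through
`eₙ = (0, …, 0, 1)`. -/
def hyperboloid (n : ℕ) : Set (Fin (n + 1) → ℝ) :=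
  {x | lorentzForm n x = -1 ∧ 0 < x (Fin.last n)}

/-- The group `SO_o(n,1)`: linear isometries of the form, of determinant one, that map the
hyperboloid model onto itself. -/
def SOo (n : ℕ) : Subgroup ((Fin (n + 1) → ℝ) ≃ₗ[ℝ] (Fin (n + 1) → ℝ)) where
  carrier := {T | (∀ x, lorentzForm n (T x) = lorentzForm n x) ∧
    LinearMap.det (T : (Fin (n + 1) → ℝ) →ₗ[ℝ] (Fin (n + 1) → ℝ)) = 1 ∧
    T '' hyperboloid n = hyperboloid n}
  one_mem' := by
    refine ⟨fun x => rfl, ?_, ?_⟩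
    · exact LinearMap.det_id
    · exact Set.image_id _
  mul_mem' := by
    rintro S T ⟨hS, dS, iS⟩ ⟨hT, dT, iT⟩
    refine ⟨fun x => (hS (T x)).trans (hT x), ?_, ?_⟩
    · exact (LinearMap.det_comp _ _).trans (by rw [dS, dT, one_mul])
    · exact (Set.image_comp S T _).trans (by rw [iT, iS])
  inv_mem' := by
    rintro T ⟨hT, dT, iT⟩
    refine ⟨fun x => ?_, ?_, ?_⟩
    · exact (hT (T.symm x)).symm.trans (congrArg _ (T.apply_symm_apply x))
    · have h := LinearEquiv.det_mul_det_symm T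
      rw [dT, one_mul] at h
      exact h
    · change T.symm '' hyperboloid n = hyperboloid n
      conv_lhs => rw [← iT]
      ext x
      simp

/-- The conformal boundary of hyperbolic `n`-space: the lines spanned by nonzero light-like
vectors. -/
def conformalBoundary (n : ℕ) : Set (Submodule ℝ (Fin (n + 1) → ℝ)) :=
  {L | ∃ v : Fin (n + 1) → ℝ, v ≠ 0 ∧ lorentzForm n v = 0 ∧ L = Submodule.span ℝ {v}}

/-- The linear endomorphism of `ℝⁿ⁺¹` underlying an element of `SO_o(n,1)`. -/
def lorentzEnd {n : ℕ} (T : SOo n) : Module.End ℝ (Fin (n + 1) → ℝ) :=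
  (T : (Fin (n + 1) → ℝ) ≃ₗ[ℝ] (Fin (n + 1) → ℝ)).toLinearMap

/-- `T` is hyperbolic: it has no fixed point in hyperbolic space and exactly two fixed points
on the conformal boundary. -/
def IsHyperbolic {n : ℕ} (T : SOo n) : Prop :=
  (∀ x ∈ hyperboloid n, lorentzEnd T x ≠ x) ∧
    {L ∈ conformalBoundary n | L.map (lorentzEnd T) = L}.ncard = 2

/-!
Write `K = T - T⁻¹`, which is skew for the Lorentz form and whose kernel is the sum of the
eigenspaces of `T` for `1` and `-1`. The three parts all follow from one criterion
(`isRealElement_iff`): `T` is real if and only if `⌊(n + 1) / 2⌋` is even or `T` has a space-like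
eigenvector `v` for the eigenvalue `1` or `-1`.

*Reversing isometries exist.* Every `T ∈ O⁺(n,1)` is inverted by an involution `S ∈ O⁺(n,1)`
(`exists_involution_reversing`). On a cyclic subspace the involution is `p(T) v ↦ p(T⁻¹) v`, which
is isometric because `T⁻¹` is the adjoint of `T`; orthogonal cyclic pieces are put together,
beginning with a time-like `v`, whose orthogonal complement is positive definite. This treats
elliptic, parabolic and hyperbolic elements alike. Only the determinant of `S` remains at issue.

*The sign.* If a space-like `v` with `T v = ± v` exists, the reflection in `v⊥` commutes with `T`
and corrects the sign. Otherwise `ker K` is at most a causal line on which `S` is the identity, and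
`K` exchanges the two eigenspaces of `S`, which forces `det S = (-1) ^ ⌊(n + 1) / 2⌋`
(`det_of_reversing_involution`). Any other reversing isometry differs from `S` by some `g`
commuting with `T`, and `det g = 1` (`det_eq_one_of_commute`): the `-1`-eigenspace of `g` is
positive definite, and carries the nondegenerate alternating form `B(K x, y)`, so its dimension is
even; and an isometry without eigenvalue `-1` has determinant one.

*Hyperbolic elements.* If `K` is injective then `det K < 0` because the form has determinant `-1`,
and this gives a real eigenvalue of absolute value less than one, so `T` is hyperbolic
(`isHyperbolic_of_skewPart_injective`). Conversely, eigenvectors of a hyperbolic element for `±1`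
are space-like (`IsHyperbolic.lorentzForm_pos`). Since `K` is skew, the parity of `n` controls
whether it is injective.
-/

/-! ### Determinants and bilinear forms -/

section BilinearForms

open Module

variable {V : Type*} [AddCommGroup V] [Module ℝ V] [FiniteDimensional ℝ V]

theorem LinearMap.BilinForm.det_eq_of_adjoint {B : LinearMap.BilinForm ℝ V}
    (hB : B.Nondegenerate) {f g : V →ₗ[ℝ] V} (h : ∀ x y, B (f x) y = B x (g y)) :
    LinearMap.det f = LinearMap.det g := by
  have key : g.dualMap = (B.toDual hB : V →ₗ[ℝ] Dual ℝ V) ∘ₗ f ∘ₗ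
      ((B.toDual hB).symm : Dual ℝ V →ₗ[ℝ] V) := by
    refine LinearMap.ext fun φ => ?_
    obtain ⟨x, rfl⟩ := (B.toDual hB).surjective φ
    ext y
    simpa [LinearMap.BilinForm.toDual_def] using (h x y).symm
  rw [← LinearMap.det_dualMap g, key, LinearMap.det_conj]

/-- A subspace on which an alternating form is nondegenerate has even dimension: the Gram matrix
is skew, hence singular in odd dimension. -/
theorem LinearMap.BilinForm.even_finrank_of_alternating {ω : LinearMap.BilinForm ℝ V}
    (hω : ∀ x y, ω x y = -ω y x) (W : Submodule ℝ V)
    (hW : ∀ x ∈ W, (∀ y ∈ W, ω x y = 0) → x = 0) : Even (finrank ℝ W) := by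
  have hnd : (ω.restrict W).Nondegenerate := by
    refine LinearMap.BilinForm.Nondegenerate.ofSeparatingLeft fun x hx => ?_
    exact Subtype.ext (hW x x.2 fun y hy => hx ⟨y, hy⟩)
  have hdet := (LinearMap.BilinForm.nondegenerate_iff_det_ne_zero (finBasis ℝ W)).1 hnd
  set G := LinearMap.BilinForm.toMatrix (finBasis ℝ W) (ω.restrict W) with hG
  have hskew : G.transpose = -G := by
    ext i j
    simpa [hG, LinearMap.BilinForm.toMatrix_apply] using hω _ _
  have h := congrArg Matrix.det hskew
  rw [Matrix.det_transpose, Matrix.det_neg, Fintype.card_fin] at h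
  by_contra hodd
  rw [(Nat.not_even_iff_odd.1 hodd).neg_one_pow] at h
  exact hdet (by linarith)

theorem LinearMap.det_of_comp_self_eq_id {σ : V →ₗ[ℝ] V} (hσ : ∀ x, σ (σ x) = x) :
    LinearMap.det σ = (-1) ^ finrank ℝ (LinearMap.ker (σ + 1)) := by
  set W := LinearMap.ker (σ + 1) with hW
  have hmem : ∀ x, x ∈ W ↔ σ x = -x := fun x => by
    simp [hW, eq_neg_iff_add_eq_zero]
  have hle : W ≤ W.comap σ := fun x hx => by
    have := (hmem x).1 hx
    simp only [Submodule.mem_comap, this]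
    exact W.neg_mem hx
  have h1 : LinearMap.restrict (p := W) (q := W) σ hle = (-1 : ℝ) • LinearMap.id := by
    ext x
    simpa using congrArg (fun v => v) ((hmem x).1 x.2)
  have h2 : W.mapQ W σ hle = LinearMap.id := by
    refine LinearMap.ext fun q => ?_
    obtain ⟨x, rfl⟩ := W.mkQ_surjective q
    simp only [Submodule.mkQ_apply, Submodule.mapQ_apply, LinearMap.id_apply]
    refine (Submodule.Quotient.eq W).2 ((hmem _).2 ?_)
    rw [map_sub, hσ, neg_sub]
  rw [LinearMap.det_eq_det_mul_det W σ hle, h1, h2, LinearMap.det_smul, LinearMap.det_id,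
    LinearMap.det_id, mul_one, mul_one]

theorem LinearMap.exists_apply_eq_smul_of_det_eq_zero {f : V →ₗ[ℝ] V} {c : ℝ}
    (h : LinearMap.det (f - c • (1 : V →ₗ[ℝ] V)) = 0) : ∃ v, v ≠ 0 ∧ f v = c • v := by
  obtain ⟨v, hv, hv0⟩ := Submodule.exists_mem_ne_zero_of_ne_bot
    (LinearMap.det_eq_zero_iff_ker_ne_bot.1 h)
  refine ⟨v, hv0, ?_⟩
  simpa [sub_eq_zero] using hv

/-- An isometry `g` of a nondegenerate form satisfies `det (g + 1) = det g * det (g⁻¹ + 1)`, and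
the two outer factors agree because `g⁻¹` is the adjoint of `g`. -/
theorem LinearMap.BilinForm.det_eq_one_of_isometry {B : LinearMap.BilinForm ℝ V}
    (hB : B.Nondegenerate) {g : V ≃ₗ[ℝ] V} (hg : ∀ x y, B (g x) (g y) = B x y)
    (h : ∀ v, g v = -v → v = 0) : LinearMap.det (g : V →ₗ[ℝ] V) = 1 := by
  have h1 : LinearMap.det ((g : V →ₗ[ℝ] V) + 1) = LinearMap.det ((g.symm : V →ₗ[ℝ] V) + 1) := by
    refine LinearMap.BilinForm.det_eq_of_adjoint hB fun x y => ?_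
    have := hg x (g.symm y)
    rw [g.apply_symm_apply] at this
    simp [this]
  have h2 : (g : V →ₗ[ℝ] V) + 1 = (g : V →ₗ[ℝ] V) ∘ₗ ((g.symm : V →ₗ[ℝ] V) + 1) := by
    ext x
    simp [add_comm]
  have h3 : LinearMap.det ((g : V →ₗ[ℝ] V) + 1) ≠ 0 := by
    intro h0
    obtain ⟨v, hv0, hv⟩ := LinearMap.exists_apply_eq_smul_of_det_eq_zero
      (f := (g : V →ₗ[ℝ] V)) (c := -1) (by simpa using h0)
    exact hv0 (h v (by simpa using hv))
  rw [h2, LinearMap.det_comp, ← h1] at h3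
  have h4 := congrArg LinearMap.det h2
  rw [LinearMap.det_comp, ← h1] at h4
  have h5 := right_ne_zero_of_mul h3
  exact mul_right_cancel₀ h5 (by rw [one_mul]; exact h4.symm)

end BilinearForms

/-- A nonsingular real skew matrix `A` has positive determinant, since `(1 - t) + t A` is
nonsingular for all `t ∈ [0, 1]`. -/
theorem Matrix.det_pos_of_skew {ι : Type*} [Fintype ι] [DecidableEq ι] {A : Matrix ι ι ℝ}
    (hA : A.transpose = -A) (h : A.det ≠ 0) : 0 < A.det := by
  have hx : ∀ x : ι → ℝ, x ⬝ᵥ A.mulVec x = 0 := fun x => by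
    have : x ⬝ᵥ A.mulVec x = -(x ⬝ᵥ A.mulVec x) := by
      conv_lhs => rw [dotProduct_comm, ← Matrix.vecMul_transpose, ← Matrix.dotProduct_mulVec, hA]
      simp [Matrix.neg_mulVec]
    linarith
  have hne : ∀ t ∈ Set.Icc (0 : ℝ) 1, ((1 - t) • (1 : Matrix ι ι ℝ) + t • A).det ≠ 0 := by
    rintro t ⟨-, ht1⟩ h0
    rcases eq_or_lt_of_le ht1 with rfl | ht1
    · simp at h0
      exact h h0
    obtain ⟨v, hv, hv0⟩ := Matrix.exists_mulVec_eq_zero_iff.2 h0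
    have h1 := congrArg (fun w => v ⬝ᵥ w) hv0
    simp only [Matrix.add_mulVec, Matrix.smul_mulVec, Matrix.one_mulVec, dotProduct_add,
      dotProduct_smul, hx, dotProduct_zero, smul_eq_mul, mul_zero, add_zero] at h1
    rcases mul_eq_zero.1 h1 with h2 | h2
    · linarith
    · exact hv (dotProduct_self_eq_zero.1 h2)
  by_contra hneg
  have hc : ContinuousOn (fun t : ℝ => ((1 - t) • (1 : Matrix ι ι ℝ) + t • A).det)
      (Set.Icc 0 1) := by
    apply Continuous.continuousOn
    apply Continuous.matrix_det
    fun_prop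
  obtain ⟨t, ht, ht0⟩ := intermediate_value_Icc' (zero_le_one' ℝ) hc
    (show (0 : ℝ) ∈ Set.Icc _ _ by simpa using not_lt.1 hneg)
  exact hne t ht ht0

/-! ### Causality in Minkowski space -/

section Minkowski

variable {n : ℕ}

/-- The symmetric bilinear form of `lorentzForm`. -/
noncomputable def lorentzBilin (n : ℕ) : LinearMap.BilinForm ℝ (Fin (n + 1) → ℝ) :=
  LinearMap.mk₂ ℝ
    (fun x y => ∑ i : Fin n, x i.castSucc * y i.castSucc - x (Fin.last n) * y (Fin.last n))
    (fun x y z => by simp only [Pi.add_apply, add_mul, Finset.sum_add_distrib]; ring)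
    (fun c x y => by
      simp only [Pi.smul_apply, smul_eq_mul, mul_assoc, ← Finset.mul_sum]; ring)
    (fun x y z => by simp only [Pi.add_apply, mul_add, Finset.sum_add_distrib]; ring)
    (fun c x y => by
      simp only [Pi.smul_apply, smul_eq_mul, mul_left_comm _ c, ← Finset.mul_sum]; ring)

theorem lorentzBilin_apply (x y : Fin (n + 1) → ℝ) : lorentzBilin n x y =
    ∑ i : Fin n, x i.castSucc * y i.castSucc - x (Fin.last n) * y (Fin.last n) := rfl

theorem lorentzBilin_self (x : Fin (n + 1) → ℝ) : lorentzBilin n x x = lorentzForm n x := by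
  simp only [lorentzBilin_apply, lorentzForm_apply, sq]

theorem lorentzBilin_comm (x y : Fin (n + 1) → ℝ) : lorentzBilin n x y = lorentzBilin n y x := by
  simp only [lorentzBilin_apply, mul_comm]

theorem lorentzForm_add (x y : Fin (n + 1) → ℝ) :
    lorentzForm n (x + y) = lorentzForm n x + 2 * lorentzBilin n x y + lorentzForm n y := by
  simp only [← lorentzBilin_self, map_add, LinearMap.add_apply, lorentzBilin_comm y x]
  ring

theorem lorentzForm_smul (c : ℝ) (x : Fin (n + 1) → ℝ) :
    lorentzForm n (c • x) = c ^ 2 * lorentzForm n x := by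
  rw [QuadraticMap.map_smul, smul_eq_mul, sq]

theorem lorentzForm_neg (x : Fin (n + 1) → ℝ) : lorentzForm n (-x) = lorentzForm n x :=
  QuadraticMap.map_neg _ _

theorem lorentzBilin_map {T : (Fin (n + 1) → ℝ) →ₗ[ℝ] (Fin (n + 1) → ℝ)}
    (hT : ∀ x, lorentzForm n (T x) = lorentzForm n x) (x y : Fin (n + 1) → ℝ) :
    lorentzBilin n (T x) (T y) = lorentzBilin n x y := by
  have h := hT (x + y)
  rw [map_add, lorentzForm_add, lorentzForm_add, hT, hT] at h
  linarith

/-- The point `(0, …, 0, 1)` of the hyperboloid. -/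
def timeVector (n : ℕ) : Fin (n + 1) → ℝ := Pi.single (Fin.last n) 1

theorem timeVector_last : timeVector n (Fin.last n) = 1 := by simp [timeVector]

theorem timeVector_castSucc (i : Fin n) : timeVector n i.castSucc = 0 := by
  simp [timeVector, Fin.castSucc_ne_last]

theorem lorentzBilin_timeVector (x : Fin (n + 1) → ℝ) :
    lorentzBilin n x (timeVector n) = -x (Fin.last n) := by
  simp [lorentzBilin_apply, timeVector_last, timeVector_castSucc]

theorem lorentzForm_timeVector : lorentzForm n (timeVector n) = -1 := by
  rw [← lorentzBilin_self, lorentzBilin_timeVector, timeVector_last]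

theorem timeVector_mem_hyperboloid : timeVector n ∈ hyperboloid n :=
  ⟨lorentzForm_timeVector, by rw [timeVector_last]; exact one_pos⟩

theorem eq_zero_of_last_eq_zero {x : Fin (n + 1) → ℝ} (h : x (Fin.last n) = 0)
    (hx : lorentzForm n x ≤ 0) : x = 0 := by
  rw [lorentzForm_apply, h] at hx
  have h0 := (Finset.sum_eq_zero_iff_of_nonneg
    fun (i : Fin n) (_ : i ∈ Finset.univ) => sq_nonneg (x i.castSucc)).1
    (le_antisymm (by linarith) (Finset.sum_nonneg fun i _ => sq_nonneg _))
  funext i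
  refine Fin.lastCases h (fun j => ?_) i
  exact pow_eq_zero_iff two_ne_zero |>.1 (h0 j (Finset.mem_univ j))

theorem lorentzBilin_nondegenerate : (lorentzBilin n).Nondegenerate := by
  refine LinearMap.BilinForm.Nondegenerate.ofSeparatingLeft fun x hx => ?_
  refine eq_zero_of_last_eq_zero ?_ ((lorentzBilin_self x).symm.trans (hx x)).le
  simpa [lorentzBilin_timeVector] using hx (timeVector n)

/-- The reversed Cauchy–Schwarz inequality, in the form of a sign: two causal vectors pointing to
the future, one of them time-like, have a negative product. -/
theorem lorentzBilin_neg_of_future {y v : Fin (n + 1) → ℝ} (hy : y ∈ hyperboloid n)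
    (hv : lorentzForm n v ≤ 0) (hv0 : 0 < v (Fin.last n)) : lorentzBilin n y v < 0 := by
  obtain ⟨hy1, hy0⟩ := hy
  rw [lorentzForm_apply] at hy1 hv
  have hcs := Finset.sum_mul_sq_le_sq_mul_sq Finset.univ
    (fun i : Fin n => y i.castSucc) (fun i => v i.castSucc)
  have hlt : (∑ i : Fin n, y i.castSucc * v i.castSucc) ^ 2
      < (y (Fin.last n) * v (Fin.last n)) ^ 2 := by
    have hs := Finset.sum_nonneg fun (i : Fin n) (_ : i ∈ Finset.univ) => sq_nonneg (y i.castSucc)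
    have hv2 := pow_pos hv0 2
    rw [mul_pow]
    nlinarith
  have := abs_lt_of_sq_lt_sq hlt (mul_pos hy0 hv0).le
  rw [lorentzBilin_apply]
  linarith [(abs_lt.1 this).2]

theorem last_ne_zero_of_causal {v : Fin (n + 1) → ℝ} (hv : lorentzForm n v ≤ 0) (h0 : v ≠ 0) :
    v (Fin.last n) ≠ 0 := fun h => h0 (eq_zero_of_last_eq_zero h hv)

theorem last_pos_of_lorentzBilin_neg {y v : Fin (n + 1) → ℝ} (hy : y ∈ hyperboloid n)
    (hv : lorentzForm n v ≤ 0) (h : lorentzBilin n y v < 0) : 0 < v (Fin.last n) := by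
  have hv0 : v ≠ 0 := by rintro rfl; simp at h
  by_contra hneg
  have hlt := lt_of_le_of_ne (not_lt.1 hneg) (last_ne_zero_of_causal hv hv0)
  have := lorentzBilin_neg_of_future hy (v := -v) (by rwa [lorentzForm_neg])
    (by simpa using hlt)
  rw [map_neg] at this
  linarith

/-- The combination of `x` and `y` whose time coordinate vanishes is zero unless it is
space-like. -/
theorem smul_eq_smul_of_lorentzForm_le {x y : Fin (n + 1) → ℝ}
    (h : lorentzForm n (y (Fin.last n) • x - x (Fin.last n) • y) ≤ 0) :
    y (Fin.last n) • x = x (Fin.last n) • y :=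
  sub_eq_zero.1 (eq_zero_of_last_eq_zero (by simp [mul_comm]) h)

theorem lorentzBilin_ne_zero_of_lightlike {x y : Fin (n + 1) → ℝ} (hx : lorentzForm n x = 0)
    (hy : lorentzForm n y = 0) (hx0 : x ≠ 0) (h : y ∉ Submodule.span ℝ {x}) :
    lorentzBilin n x y ≠ 0 := by
  intro h0
  have hl := last_ne_zero_of_causal hx.le hx0
  have := smul_eq_smul_of_lorentzForm_le (x := x) (y := y) (by
    rw [sub_eq_add_neg, lorentzForm_add, lorentzForm_neg, lorentzForm_smul, lorentzForm_smul,
      hx, hy, ← neg_smul, map_smul, map_smul, LinearMap.smul_apply, h0]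
    simp)
  refine h (Submodule.mem_span_singleton.2 ⟨(x (Fin.last n))⁻¹ * y (Fin.last n), ?_⟩)
  rw [mul_smul, this, smul_smul, inv_mul_cancel₀ hl, one_smul]

theorem exists_smul_mem_hyperboloid {x : Fin (n + 1) → ℝ} (hx : lorentzForm n x < 0) :
    ∃ c : ℝ, c • x ∈ hyperboloid n := by
  have hl := last_ne_zero_of_causal hx.le (by rintro rfl; simp at hx)
  set r := Real.sqrt (-lorentzForm n x) with hr
  have hr0 : 0 < r := Real.sqrt_pos.2 (by linarith)
  have hr2 : r ^ 2 = -lorentzForm n x := Real.sq_sqrt (by linarith)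
  have hform : lorentzForm n (r⁻¹ • x) = -1 := by
    have : lorentzForm n x ≠ 0 := hx.ne
    rw [lorentzForm_smul, inv_pow, hr2, ← div_eq_inv_mul, div_neg, div_self this]
  rcases lt_or_gt_of_ne hl with h | h
  · refine ⟨-r⁻¹, ?_, ?_⟩
    · rw [neg_smul, lorentzForm_neg, hform]
    · have := mul_pos (inv_pos.2 hr0) (neg_pos.2 h)
      simpa using this
  · exact ⟨r⁻¹, hform, by simpa using mul_pos (inv_pos.2 hr0) h⟩

end Minkowski

/-! ### Orthochronous isometries -/

section Orthochronous

variable {n : ℕ}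

/-- The group `O⁺(n,1)` of linear isometries of the form that map the hyperboloid onto itself. -/
def orthochronous (n : ℕ) : Subgroup ((Fin (n + 1) → ℝ) ≃ₗ[ℝ] (Fin (n + 1) → ℝ)) where
  carrier := {T | (∀ x, lorentzForm n (T x) = lorentzForm n x) ∧
    T '' hyperboloid n = hyperboloid n}
  one_mem' := ⟨fun _ => rfl, Set.image_id _⟩
  mul_mem' := by
    rintro S T ⟨hS, iS⟩ ⟨hT, iT⟩
    exact ⟨fun x => (hS (T x)).trans (hT x), (Set.image_comp S T _).trans (by rw [iT, iS])⟩
  inv_mem' := by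
    rintro T ⟨hT, iT⟩
    refine ⟨fun x => (hT (T.symm x)).symm.trans (congrArg _ (T.apply_symm_apply x)), ?_⟩
    change T.symm '' hyperboloid n = hyperboloid n
    conv_lhs => rw [← iT]
    ext x
    simp

theorem mem_SOo_iff {T : (Fin (n + 1) → ℝ) ≃ₗ[ℝ] (Fin (n + 1) → ℝ)} : T ∈ SOo n ↔
    T ∈ orthochronous n ∧ LinearMap.det (T : (Fin (n + 1) → ℝ) →ₗ[ℝ] (Fin (n + 1) → ℝ)) = 1 :=
  ⟨fun h => ⟨⟨h.1, h.2.2⟩, h.2.1⟩, fun h => ⟨h.1.1, h.2, h.1.2⟩⟩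

variable {T : (Fin (n + 1) → ℝ) ≃ₗ[ℝ] (Fin (n + 1) → ℝ)}

theorem lorentzBilin_map_of_mem (hT : T ∈ orthochronous n) (x y : Fin (n + 1) → ℝ) :
    lorentzBilin n (T x) (T y) = lorentzBilin n x y :=
  lorentzBilin_map (T := (T : (Fin (n + 1) → ℝ) →ₗ[ℝ] (Fin (n + 1) → ℝ))) hT.1 x y

theorem lorentzBilin_symm_right (hT : T ∈ orthochronous n) (x y : Fin (n + 1) → ℝ) :
    lorentzBilin n x (T.symm y) = lorentzBilin n (T x) y := by
  rw [← lorentzBilin_map_of_mem hT, T.apply_symm_apply]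

theorem map_mem_hyperboloid (hT : T ∈ orthochronous n) {x : Fin (n + 1) → ℝ}
    (hx : x ∈ hyperboloid n) : T x ∈ hyperboloid n := hT.2 ▸ Set.mem_image_of_mem T hx

/-- An isometry is orthochronous as soon as it maps one point of the hyperboloid to another. -/
theorem mem_orthochronous_of_map_mem (hT : ∀ x, lorentzForm n (T x) = lorentzForm n x)
    {p : Fin (n + 1) → ℝ} (hp : p ∈ hyperboloid n) (hTp : T p ∈ hyperboloid n) :
    T ∈ orthochronous n := by
  have key : ∀ (U : (Fin (n + 1) → ℝ) ≃ₗ[ℝ] (Fin (n + 1) → ℝ)),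
      (∀ x, lorentzForm n (U x) = lorentzForm n x) → ∀ q ∈ hyperboloid n, U q ∈ hyperboloid n →
      ∀ x ∈ hyperboloid n, U x ∈ hyperboloid n := by
    intro U hU q hq hUq x hx
    have h1 : lorentzForm n (U x) = -1 := (hU x).trans hx.1
    refine ⟨h1, last_pos_of_lorentzBilin_neg hUq (by rw [h1]; norm_num) ?_⟩
    refine (lorentzBilin_map (T := (U : (Fin (n + 1) → ℝ) →ₗ[ℝ] (Fin (n + 1) → ℝ)))
      hU q x).trans_lt ?_
    exact lorentzBilin_neg_of_future hq (by rw [hx.1]; norm_num) hx.2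
  refine ⟨hT, Set.Subset.antisymm ?_ fun x hx => ⟨T.symm x, ?_, T.apply_symm_apply x⟩⟩
  · rintro _ ⟨x, hx, rfl⟩
    exact key T hT p hp hTp x hx
  · refine key T.symm (fun x => ?_) (T p) hTp (by rwa [T.symm_apply_apply]) x hx
    rw [← hT, T.apply_symm_apply]

/-- Causal eigenvectors of an orthochronous isometry have positive eigenvalues. -/
theorem eigenvalue_pos_of_causal (hT : T ∈ orthochronous n) {v : Fin (n + 1) → ℝ} {c : ℝ}
    (hv : T v = c • v) (hv0 : v ≠ 0) (hQ : lorentzForm n v ≤ 0) : 0 < c := by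
  have key : ∀ w : Fin (n + 1) → ℝ, T w = c • w → lorentzForm n w ≤ 0 → 0 < w (Fin.last n) →
      0 < c := by
    intro w hw hQw hw0
    have h1 := lorentzBilin_neg_of_future timeVector_mem_hyperboloid hQw hw0
    have h2 := lorentzBilin_neg_of_future (map_mem_hyperboloid hT timeVector_mem_hyperboloid)
      hQw hw0
    rw [← lorentzBilin_map_of_mem hT, hw, map_smul, smul_eq_mul] at h1
    exact pos_of_mul_neg_left h1 h2.le
  rcases lt_or_gt_of_ne (last_ne_zero_of_causal hQ hv0) with h | h
  · exact key (-v) (by simp [hv]) (by rwa [lorentzForm_neg]) (by simpa using h)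
  · exact key v hv hQ h

theorem lorentzForm_pos_of_map_eq_neg (hT : T ∈ orthochronous n) {v : Fin (n + 1) → ℝ}
    (hv : T v = -v) (hv0 : v ≠ 0) : 0 < lorentzForm n v := by
  by_contra h
  have := eigenvalue_pos_of_causal hT (c := -1) (by simpa using hv) hv0 (not_lt.1 h)
  linarith

end Orthochronous

/-! ### Reversing involutions -/

section Reversal

variable {n : ℕ} {T : (Fin (n + 1) → ℝ) ≃ₗ[ℝ] (Fin (n + 1) → ℝ)}

/-- A linear relation that behaves like the graph of a partially defined isometric involution
conjugating `T` to `T⁻¹`. -/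
structure IsReversalRelation (T : (Fin (n + 1) → ℝ) ≃ₗ[ℝ] (Fin (n + 1) → ℝ))
    (R : Submodule ℝ ((Fin (n + 1) → ℝ) × (Fin (n + 1) → ℝ))) : Prop where
  isometric : ∀ p ∈ R, ∀ q ∈ R, lorentzBilin n p.1 q.1 = lorentzBilin n p.2 q.2
  swap_mem : ∀ p ∈ R, p.swap ∈ R
  step_mem : ∀ p ∈ R, (T p.1, T.symm p.2) ∈ R

/-- The relation `p(T) v ↦ p(T⁻¹) v`, where `p` runs over the Laurent polynomials. -/
def cyclicReversal (T : (Fin (n + 1) → ℝ) ≃ₗ[ℝ] (Fin (n + 1) → ℝ)) (v : Fin (n + 1) → ℝ) :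
    Submodule ℝ ((Fin (n + 1) → ℝ) × (Fin (n + 1) → ℝ)) :=
  Submodule.span ℝ (Set.range fun k : ℤ => ((T ^ k) v, (T ^ (-k)) v))

theorem self_mem_cyclicReversal (v : Fin (n + 1) → ℝ) : (v, v) ∈ cyclicReversal T v :=
  Submodule.subset_span ⟨0, by simp⟩

theorem IsReversalRelation.zpow_mem
    {R : Submodule ℝ ((Fin (n + 1) → ℝ) × (Fin (n + 1) → ℝ))} (hR : IsReversalRelation T R)
    {p : (Fin (n + 1) → ℝ) × (Fin (n + 1) → ℝ)} (hp : p ∈ R) (k : ℤ) :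
    ((T ^ k) p.1, (T ^ (-k)) p.2) ∈ R := by
  induction k with
  | zero => simpa using hp
  | succ k ih =>
    have := hR.step_mem _ ih
    rw [add_comm (k : ℤ), zpow_one_add, neg_add, zpow_add, zpow_neg_one]
    exact this
  | pred k ih =>
    have := hR.swap_mem _ (hR.step_mem _ (hR.swap_mem _ ih))
    rw [sub_eq_neg_add, zpow_add, zpow_neg_one, neg_add, neg_neg (1 : ℤ), zpow_one_add]
    exact this

theorem lorentzBilin_zpow_left (hT : T ∈ orthochronous n) (k : ℤ) (x y : Fin (n + 1) → ℝ) :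
    lorentzBilin n ((T ^ k) x) y = lorentzBilin n x ((T ^ (-k)) y) := by
  rw [← lorentzBilin_map_of_mem ((orthochronous n).zpow_mem hT k) x, ← LinearEquiv.mul_apply,
    ← zpow_add, add_neg_cancel, zpow_zero, LinearEquiv.coe_one, id]

theorem IsReversalRelation.bot : IsReversalRelation T ⊥ := by
  refine ⟨?_, ?_, ?_⟩ <;> simp +contextual [Submodule.mem_bot]

/-- A reversal relation can be enlarged by the cyclic relation of any vector orthogonal to its
domain. -/
theorem IsReversalRelation.sup_cyclicReversal (hT : T ∈ orthochronous n)
    {R : Submodule ℝ ((Fin (n + 1) → ℝ) × (Fin (n + 1) → ℝ))} (hR : IsReversalRelation T R)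
    {v : Fin (n + 1) → ℝ} (hv : ∀ p ∈ R, lorentzBilin n p.1 v = 0) :
    IsReversalRelation T (R ⊔ cyclicReversal T v) := by
  have hsub : cyclicReversal T v ≤ R ⊔ cyclicReversal T v := le_sup_right
  have hcross : ∀ p ∈ R, ∀ q ∈ cyclicReversal T v,
      lorentzBilin n p.1 q.1 = 0 ∧ lorentzBilin n p.2 q.2 = 0 := by
    have h1 : ∀ p ∈ R, ∀ k : ℤ, lorentzBilin n p.1 ((T ^ k) v) = 0 := by
      intro p hp k
      rw [← neg_neg k, ← lorentzBilin_zpow_left hT]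
      exact hv _ (hR.zpow_mem hp (-k))
    intro p hp q hq
    refine Submodule.span_induction ?_ (by simp) ?_ ?_ hq
    · rintro _ ⟨k, rfl⟩
      exact ⟨h1 p hp k, h1 _ (hR.swap_mem p hp) (-k)⟩
    · rintro q q' - - ⟨h, h'⟩ ⟨k, k'⟩
      simp [h, h', k, k']
    · rintro c q - ⟨h, h'⟩
      simp [h, h']
  have hself : ∀ p ∈ cyclicReversal T v, ∀ q ∈ cyclicReversal T v,
      lorentzBilin n p.1 q.1 = lorentzBilin n p.2 q.2 := by
    intro p hp q hq
    refine Submodule.span_induction ?_ (by simp) ?_ ?_ hp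
    · rintro _ ⟨k, rfl⟩
      refine Submodule.span_induction ?_ (by simp) ?_ ?_ hq
      · rintro _ ⟨l, rfl⟩
        change lorentzBilin n ((T ^ k) v) ((T ^ l) v) =
          lorentzBilin n ((T ^ (-k)) v) ((T ^ (-l)) v)
        rw [lorentzBilin_comm, lorentzBilin_zpow_left hT, lorentzBilin_zpow_left hT,
          ← LinearEquiv.mul_apply, ← LinearEquiv.mul_apply, ← zpow_add, ← zpow_add, neg_neg,
          add_comm k]
      · intro q q' _ _ h h'
        simp only [Prod.fst_add, Prod.snd_add, map_add, h, h']
      · intro c q _ h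
        simp only [Prod.smul_fst, Prod.smul_snd, map_smul, h]
    · intro q q' _ _ h h'
      simp only [Prod.fst_add, Prod.snd_add, map_add, LinearMap.add_apply, h, h']
    · intro c q _ h
      simp only [Prod.smul_fst, Prod.smul_snd, map_smul, LinearMap.smul_apply, h]
  refine ⟨?_, ?_, ?_⟩
  · intro p hp q hq
    obtain ⟨p₁, hp₁, p₂, hp₂, rfl⟩ := Submodule.mem_sup.1 hp
    obtain ⟨q₁, hq₁, q₂, hq₂, rfl⟩ := Submodule.mem_sup.1 hq
    simp only [Prod.fst_add, Prod.snd_add, map_add, LinearMap.add_apply]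
    rw [hR.isometric _ hp₁ _ hq₁, hself _ hp₂ _ hq₂, (hcross _ hp₁ _ hq₂).1,
      (hcross _ hp₁ _ hq₂).2, lorentzBilin_comm p₂.1 q₁.1, lorentzBilin_comm p₂.2 q₁.2,
      (hcross _ hq₁ _ hp₂).1, (hcross _ hq₁ _ hp₂).2]
  · have : R ⊔ cyclicReversal T v ≤ (R ⊔ cyclicReversal T v).comap
        (LinearEquiv.prodComm ℝ (Fin (n + 1) → ℝ) (Fin (n + 1) → ℝ)).toLinearMap := by
      refine sup_le (fun p hp => Submodule.mem_sup_left (hR.swap_mem p hp))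
        (Submodule.span_le.2 ?_)
      rintro _ ⟨k, rfl⟩
      exact hsub (Submodule.subset_span ⟨-k, by simp⟩)
    exact this
  · have : R ⊔ cyclicReversal T v ≤ (R ⊔ cyclicReversal T v).comap
        (LinearMap.prodMap T.toLinearMap T.symm.toLinearMap) := by
      refine sup_le (fun p hp => Submodule.mem_sup_left (hR.step_mem p hp))
        (Submodule.span_le.2 ?_)
      rintro _ ⟨k, rfl⟩
      refine hsub (Submodule.subset_span ⟨1 + k, ?_⟩)
      simp only [neg_add, zpow_add, zpow_neg_one]
      rfl
    exact this

/-- Every orthochronous isometry is inverted by an orthochronous involution. The involution is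
obtained from a maximal reversal relation containing `(timeVector n, timeVector n)`: since the
complement of a time-like vector is positive definite, such a relation is a graph, and its domain
is everything because otherwise it could be enlarged. -/
theorem exists_involution_reversing (hT : T ∈ orthochronous n) :
    ∃ S ∈ orthochronous n, (∀ x, S (S x) = x) ∧ ∀ x, S (T x) = T.symm (S x) := by
  set 𝓡 : Set (Submodule ℝ ((Fin (n + 1) → ℝ) × (Fin (n + 1) → ℝ))) :=
    {R | IsReversalRelation T R ∧ (timeVector n, timeVector n) ∈ R}
  have hne : 𝓡.Nonempty := ⟨⊥ ⊔ cyclicReversal T (timeVector n),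
    IsReversalRelation.bot.sup_cyclicReversal hT (by simp [Submodule.mem_bot]),
    Submodule.mem_sup_right (self_mem_cyclicReversal _)⟩
  obtain ⟨R, ⟨hR, he⟩, hmax⟩ := WellFounded.has_min wellFounded_gt 𝓡 hne
  have hzero : ∀ p ∈ R, p.1 = 0 → p.2 = 0 := by
    intro p hp h0
    refine eq_zero_of_last_eq_zero ?_ ?_
    · have := hR.isometric _ hp _ he
      simpa [h0, lorentzBilin_timeVector] using this
    · rw [← lorentzBilin_self, ← hR.isometric _ hp _ hp, h0, map_zero]
  have hsurj : R.map (LinearMap.fst ℝ _ _) = ⊤ := by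
    by_contra htop
    obtain ⟨f, hf, hRf⟩ := Submodule.exists_le_ker_of_lt_top _ (lt_top_iff_ne_top.2 htop)
    set v := ((lorentzBilin n).toDual lorentzBilin_nondegenerate).symm f
    have hv : ∀ p ∈ R, lorentzBilin n p.1 v = 0 := by
      intro p hp
      rw [lorentzBilin_comm, LinearMap.BilinForm.apply_toDual_symm_apply]
      exact hRf (Submodule.mem_map_of_mem hp)
    have hv0 : v ≠ 0 := by simpa [v] using hf
    refine hmax (R ⊔ cyclicReversal T v) ⟨hR.sup_cyclicReversal hT hv, Submodule.mem_sup_left he⟩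
      (lt_of_le_of_ne le_sup_left fun heq => hv0 ?_)
    have hmem : (v, v) ∈ R := heq ▸ Submodule.mem_sup_right (self_mem_cyclicReversal v)
    refine eq_zero_of_last_eq_zero ?_ ?_
    · have := hv _ he
      rw [lorentzBilin_comm, lorentzBilin_timeVector] at this
      linarith
    · exact (lorentzBilin_self v ▸ hv _ hmem).le
  have hbij : Function.Bijective ((LinearMap.fst ℝ _ _).domRestrict R) := by
    refine ⟨(injective_iff_map_eq_zero _).2 fun p hp => ?_, fun x => ?_⟩
    · exact Subtype.ext (Prod.ext hp (hzero p p.2 hp))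
    · obtain ⟨p, hp, hpx⟩ := hsurj.ge (Submodule.mem_top (x := x))
      exact ⟨⟨p, hp⟩, hpx⟩
  set E := LinearEquiv.ofBijective _ hbij
  set s : (Fin (n + 1) → ℝ) →ₗ[ℝ] (Fin (n + 1) → ℝ) :=
    LinearMap.snd ℝ _ _ ∘ₗ R.subtype ∘ₗ E.symm.toLinearMap with hs
  have hgraph : ∀ x, (x, s x) ∈ R := by
    intro x
    have h1 : ((E.symm x : R) : (Fin (n + 1) → ℝ) × (Fin (n + 1) → ℝ)).1 = x :=
      E.apply_symm_apply x
    have h2 : ((x, s x) : (Fin (n + 1) → ℝ) × (Fin (n + 1) → ℝ)) = (E.symm x : R) :=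
      Prod.ext h1.symm rfl
    rw [h2]
    exact (E.symm x).2
  have huniq : ∀ x y, (x, y) ∈ R → s x = y := by
    intro x y hxy
    have := hzero _ (R.sub_mem (hgraph x) hxy) (by simp)
    exact sub_eq_zero.1 this
  have hinv : Function.Involutive s := fun x => huniq _ _ (hR.swap_mem _ (hgraph x))
  refine ⟨LinearEquiv.ofInvolutive s hinv, ?_, hinv, fun x => huniq _ _ (hR.step_mem _ (hgraph x))⟩
  refine mem_orthochronous_of_map_mem (fun x => ?_) timeVector_mem_hyperboloid ?_
  · have := hR.isometric _ (hgraph x) _ (hgraph x)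
    rw [lorentzBilin_self, lorentzBilin_self] at this
    exact this.symm
  · have : LinearEquiv.ofInvolutive s hinv (timeVector n) = timeVector n := huniq _ _ he
    rw [this]
    exact timeVector_mem_hyperboloid

end Reversal

/-! ### Determinants of reversing isometries -/

section Master

open Module

variable {n : ℕ} {T : (Fin (n + 1) → ℝ) ≃ₗ[ℝ] (Fin (n + 1) → ℝ)}

/-- The endomorphism `T - T⁻¹`; it is skew for the form, and its kernel is the sum of the
eigenspaces of `T` for `1` and `-1`. -/
def skewPart (T : (Fin (n + 1) → ℝ) ≃ₗ[ℝ] (Fin (n + 1) → ℝ)) :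
    (Fin (n + 1) → ℝ) →ₗ[ℝ] (Fin (n + 1) → ℝ) :=
  T.toLinearMap - T.symm.toLinearMap

theorem skewPart_apply (x : Fin (n + 1) → ℝ) : skewPart T x = T x - T.symm x := rfl

theorem lorentzBilin_skewPart (hT : T ∈ orthochronous n) (x y : Fin (n + 1) → ℝ) :
    lorentzBilin n (skewPart T x) y = -lorentzBilin n (skewPart T y) x := by
  rw [skewPart_apply, skewPart_apply, map_sub, map_sub, LinearMap.sub_apply, LinearMap.sub_apply,
    ← lorentzBilin_symm_right hT, ← lorentzBilin_symm_right hT, lorentzBilin_comm (T.symm x),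
    lorentzBilin_comm (T.symm y)]
  ring

theorem skewPart_eq_zero_iff {x : Fin (n + 1) → ℝ} : skewPart T x = 0 ↔ T (T x) = x := by
  rw [skewPart_apply, sub_eq_zero, LinearEquiv.eq_symm_apply]

theorem skewPart_eq_zero_of_eigenvector {x : Fin (n + 1) → ℝ} (h : T x = x ∨ T x = -x) :
    skewPart T x = 0 := by
  rw [skewPart_eq_zero_iff]
  rcases h with h | h <;> simp [h]

theorem exists_eigenvector_of_skewPart_eq_zero {x : Fin (n + 1) → ℝ} (hx : x ≠ 0)
    (h : skewPart T x = 0) : ∃ v, v ≠ 0 ∧ (T v = v ∨ T v = -v) := by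
  rw [skewPart_eq_zero_iff] at h
  by_cases h0 : x - T x = 0
  · exact ⟨x, hx, Or.inl (sub_eq_zero.1 h0).symm⟩
  · exact ⟨x - T x, h0, Or.inr (by rw [map_sub, h, neg_sub])⟩

/-- `T` has a space-like eigenvector for the eigenvalue `1` or `-1`. -/
def HasSpacelikeUnitEigenvector (T : (Fin (n + 1) → ℝ) ≃ₗ[ℝ] (Fin (n + 1) → ℝ)) : Prop :=
  ∃ v, 0 < lorentzForm n v ∧ (T v = v ∨ T v = -v)

theorem lorentzForm_le_of_not_hasSpacelikeUnitEigenvector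
    (hno : ¬ HasSpacelikeUnitEigenvector T) {v : Fin (n + 1) → ℝ} (hv : T v = v ∨ T v = -v) :
    lorentzForm n v ≤ 0 := not_lt.1 fun h => hno ⟨v, h, hv⟩

theorem map_eq_self_of_skewPart_eq_zero (hT : T ∈ orthochronous n)
    (hno : ¬ HasSpacelikeUnitEigenvector T) {x : Fin (n + 1) → ℝ} (h : skewPart T x = 0) :
    T x = x := by
  rw [skewPart_eq_zero_iff] at h
  have hy : T (x - T x) = -(x - T x) := by rw [map_sub, h, neg_sub]
  by_contra hne
  have := lorentzForm_pos_of_map_eq_neg hT hy fun h0 => hne (sub_eq_zero.1 h0).symm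
  exact hno ⟨_, this, Or.inr hy⟩

theorem eq_zero_of_skewPart_eq_zero_of_last_eq_zero (hT : T ∈ orthochronous n)
    (hno : ¬ HasSpacelikeUnitEigenvector T) {x : Fin (n + 1) → ℝ} (h : skewPart T x = 0)
    (hl : x (Fin.last n) = 0) : x = 0 :=
  eq_zero_of_last_eq_zero hl (lorentzForm_le_of_not_hasSpacelikeUnitEigenvector hno
    (Or.inl (map_eq_self_of_skewPart_eq_zero hT hno h)))

/-- Without space-like eigenvectors for `±1`, the kernel of `T - T⁻¹` is at most a line and lies in
the `1`-eigenspace of a reversing involution `S`. As `T - T⁻¹` exchanges the two eigenspaces of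
`S`, their dimensions differ by at most one. -/
theorem det_of_reversing_involution (hT : T ∈ orthochronous n)
    (hno : ¬ HasSpacelikeUnitEigenvector T) {S : (Fin (n + 1) → ℝ) ≃ₗ[ℝ] (Fin (n + 1) → ℝ)}
    (hS : S ∈ orthochronous n) (hSS : ∀ x, S (S x) = x) (hST : ∀ x, S (T x) = T.symm (S x)) :
    LinearMap.det (S : (Fin (n + 1) → ℝ) →ₗ[ℝ] (Fin (n + 1) → ℝ)) = (-1) ^ ((n + 1) / 2) := by
  set s : (Fin (n + 1) → ℝ) →ₗ[ℝ] (Fin (n + 1) → ℝ) := S.toLinearMap with hs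
  set N := LinearMap.ker (s + 1) with hN
  set P := LinearMap.ker (s - 1) with hP
  have hNmem : ∀ x, x ∈ N ↔ S x = -x := fun x => by
    simp [hN, hs, eq_neg_iff_add_eq_zero]
  have hPmem : ∀ x, x ∈ P ↔ S x = x := fun x => by
    simp [hP, hs, sub_eq_zero]
  have hanti : ∀ x, S (skewPart T x) = -skewPart T (S x) := by
    intro x
    have h2 : S (T.symm x) = T (S x) := by
      have := hST (T.symm x)
      rw [T.apply_symm_apply] at this
      rw [this, T.apply_symm_apply]
    rw [skewPart_apply, skewPart_apply, map_sub, hST, h2, neg_sub]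
  have hsum : finrank ℝ P + finrank ℝ N = n + 1 := by
    have hrange : LinearMap.range (s + 1) = P := by
      ext x
      constructor
      · rintro ⟨y, rfl⟩
        rw [hPmem]
        simp [hs, hSS, add_comm]
      · intro hx
        refine ⟨(1 / 2 : ℝ) • x, ?_⟩
        have := (hPmem x).1 hx
        simp only [hs, LinearMap.add_apply, LinearEquiv.coe_coe, map_smul, this,
          Module.End.one_apply]
        module
    have := LinearMap.finrank_range_add_finrank_ker (s + 1)
    rw [hrange] at this
    simpa using this
  have hNP : ∀ x ∈ N, skewPart T x ∈ P := fun x hx => by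
    rw [hPmem, hanti, (hNmem x).1 hx, map_neg, neg_neg]
  have hPN : ∀ x ∈ P, skewPart T x ∈ N := fun x hx => by
    rw [hNmem, hanti, (hPmem x).1 hx]
  have h1 : finrank ℝ N ≤ finrank ℝ P := by
    refine LinearMap.finrank_le_finrank_of_injective (f := (skewPart T).restrict hNP)
      ((injective_iff_map_eq_zero _).2 ?_)
    rintro ⟨x, hx⟩ h
    have h0 : skewPart T x = 0 := congrArg Subtype.val h
    have hle := lorentzForm_le_of_not_hasSpacelikeUnitEigenvector hno
      (Or.inl (map_eq_self_of_skewPart_eq_zero hT hno h0))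
    by_contra hne
    have := lorentzForm_pos_of_map_eq_neg hS ((hNmem x).1 hx) fun hx0 => hne (Subtype.ext hx0)
    linarith
  have h2 : finrank ℝ P ≤ finrank ℝ (N × ℝ) := by
    refine LinearMap.finrank_le_finrank_of_injective
      (f := ((skewPart T).restrict hPN).prod
        ((LinearMap.proj (R := ℝ) (φ := fun _ => ℝ) (Fin.last n)).domRestrict P))
      ((injective_iff_map_eq_zero _).2 ?_)
    rintro ⟨x, hx⟩ h
    have h0 : skewPart T x = 0 := congrArg (fun p => ((p.1 : N) : Fin (n + 1) → ℝ)) h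
    have hl : x (Fin.last n) = 0 := congrArg Prod.snd h
    exact Subtype.ext (eq_zero_of_skewPart_eq_zero_of_last_eq_zero hT hno h0 hl)
  rw [finrank_prod, finrank_self] at h2
  rw [LinearMap.det_of_comp_self_eq_id (σ := s) hSS]
  congr 1
  change finrank ℝ N = _
  omega

/-- The orthogonal involution that is `-1` on a positive definite subspace of even dimension can
be used to remove the eigenvalue `-1` from an isometry without changing its determinant. -/
theorem det_eq_one_of_commute (hT : T ∈ orthochronous n)
    (hno : ¬ HasSpacelikeUnitEigenvector T) {g : (Fin (n + 1) → ℝ) ≃ₗ[ℝ] (Fin (n + 1) → ℝ)}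
    (hg : g ∈ orthochronous n) (hgT : ∀ x, g (T x) = T (g x)) :
    LinearMap.det (g : (Fin (n + 1) → ℝ) →ₗ[ℝ] (Fin (n + 1) → ℝ)) = 1 := by
  set W := LinearMap.ker (g.toLinearMap + 1) with hW
  have hmem : ∀ x, x ∈ W ↔ g x = -x := fun x => by
    simp [hW, eq_neg_iff_add_eq_zero]
  have hpos : ∀ x ∈ W, lorentzForm n x ≤ 0 → x = 0 := fun x hx hle => by
    by_contra h0
    exact absurd (lorentzForm_pos_of_map_eq_neg hg ((hmem x).1 hx) h0) (not_lt.2 hle)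
  have hgT' : ∀ x, g (T.symm x) = T.symm (g x) := fun x => by
    rw [LinearEquiv.eq_symm_apply, ← hgT, T.apply_symm_apply]
  have heven : Even (finrank ℝ W) := by
    refine LinearMap.BilinForm.even_finrank_of_alternating
      (ω := (lorentzBilin n) ∘ₗ skewPart T) (lorentzBilin_skewPart hT) W fun x hx h => ?_
    have hKx : skewPart T x ∈ W := by
      rw [hmem, skewPart_apply, map_sub, hgT, hgT', (hmem x).1 hx, map_neg, map_neg]
      abel
    have h0 : skewPart T x = 0 :=
      hpos _ hKx ((lorentzBilin_self _).symm.trans (h _ hKx)).le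
    exact hpos x hx (lorentzForm_le_of_not_hasSpacelikeUnitEigenvector hno
      (Or.inl (map_eq_self_of_skewPart_eq_zero hT hno h0)))
  have hcompl : IsCompl W ((lorentzBilin n).orthogonal W) := by
    refine (LinearMap.BilinForm.isCompl_orthogonal_iff_disjoint fun x y h => ?_).2 ?_
    · rw [lorentzBilin_comm, h]
    · refine Submodule.disjoint_def.2 fun x hx hx' => hpos x hx ?_
      exact ((lorentzBilin_self x).symm.trans (hx' x hx)).le
  set π := W.projection _ hcompl with hπ
  have hπW : ∀ x, π x ∈ W := fun x => Submodule.projection_apply_mem hcompl x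
  have hπo : ∀ x, ∀ w ∈ W, lorentzBilin n w (x - π x) = 0 := fun x w hw =>
    Submodule.sub_projection_mem hcompl x w hw
  have hππ : ∀ x ∈ W, π x = x := fun x hx =>
    Submodule.projection_apply_of_mem_left hcompl hx
  set r : (Fin (n + 1) → ℝ) →ₗ[ℝ] (Fin (n + 1) → ℝ) := 1 - (2 : ℝ) • π with hr
  have hrx : ∀ x, r x = x - (2 : ℝ) • π x := fun x => by simp [hr]
  have hrr : Function.Involutive r := fun x => by
    rw [hrx, hrx, map_sub, map_smul, hππ _ (hπW x)]
    module
  have hrQ : ∀ x, lorentzForm n (r x) = lorentzForm n x := by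
    intro x
    have h1 : r x = (x - π x) + -π x := by rw [hrx]; module
    have h2 : lorentzForm n x = lorentzForm n ((x - π x) + π x) := by rw [sub_add_cancel]
    have h3 := hπo x _ (hπW x)
    rw [lorentzBilin_comm] at h3
    rw [h1, h2, lorentzForm_add, lorentzForm_add, map_neg, h3, lorentzForm_neg]
    ring
  have hdetr : LinearMap.det r = 1 := by
    have hker : LinearMap.ker (r + 1) = W := by
      ext x
      have : (r + 1) x = (2 : ℝ) • (x - π x) := by
        rw [LinearMap.add_apply, hrx, Module.End.one_apply]; module
      rw [LinearMap.mem_ker, this]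
      constructor
      · intro h
        have h0 := (smul_eq_zero.1 h).resolve_left two_ne_zero
        rw [sub_eq_zero.1 h0]
        exact hπW x
      · intro hx
        rw [hππ x hx, sub_self, smul_zero]
    rw [LinearMap.det_of_comp_self_eq_id hrr, hker, heven.neg_one_pow]
  have hgr := LinearMap.BilinForm.det_eq_one_of_isometry lorentzBilin_nondegenerate
    (g := (LinearEquiv.ofInvolutive r hrr).trans g)
    (fun x y => (lorentzBilin_map_of_mem hg _ _).trans (lorentzBilin_map hrQ x y)) (by
      intro x hx
      have hx : g (r x) = -x := hx
      have h1 : r x = (x - π x) - π x := by rw [hrx]; module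
      rw [h1, map_sub, (hmem _).1 (hπW x)] at hx
      have h2 : g (x - π x) = -(x - π x) - (2 : ℝ) • π x := by
        have h3 : g (x - π x) = -x - π x := by rw [← hx]; abel
        rw [h3]; module
      have h3 : lorentzBilin n (π x) (g (x - π x)) = 0 := by
        have := lorentzBilin_map_of_mem hg (π x) (x - π x)
        rw [hπo x _ (hπW x), (hmem _).1 (hπW x), map_neg, LinearMap.neg_apply, neg_eq_zero] at this
        exact this
      rw [h2, map_sub, map_neg, hπo x _ (hπW x), map_smul, lorentzBilin_self, smul_eq_mul] at h3
      have h4 : π x = 0 := hpos _ (hπW x) (by linarith)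
      rw [h4, sub_zero, smul_zero, sub_zero] at h2
      have h5 := hππ x ((hmem x).2 h2)
      rw [← h5, h4])
  have : (((LinearEquiv.ofInvolutive r hrr).trans g : (Fin (n + 1) → ℝ) ≃ₗ[ℝ] _) :
      (Fin (n + 1) → ℝ) →ₗ[ℝ] (Fin (n + 1) → ℝ)) = g.toLinearMap ∘ₗ r := rfl
  rw [this, LinearMap.det_comp, hdetr, mul_one] at hgr
  exact hgr

/-- The reflection in the hyperplane orthogonal to a space-like `v` commutes with `T` whenever
`v` is an eigenvector of `T` for `1` or `-1`. -/
theorem exists_reflection_commute (hT : T ∈ orthochronous n)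
    (h : HasSpacelikeUnitEigenvector T) : ∃ r ∈ orthochronous n, (∀ x, r (T x) = T (r x)) ∧
      LinearMap.det (r : (Fin (n + 1) → ℝ) →ₗ[ℝ] (Fin (n + 1) → ℝ)) = -1 := by
  obtain ⟨v, hv, hTv⟩ := h
  set r : (Fin (n + 1) → ℝ) →ₗ[ℝ] (Fin (n + 1) → ℝ) :=
    1 - (2 / lorentzForm n v) • (lorentzBilin n v).smulRight v with hr
  have hrx : ∀ x, r x = x - (2 / lorentzForm n v * lorentzBilin n v x) • v := fun x => by
    simp [hr, smul_smul]
  have hv0 : v ≠ 0 := by rintro rfl; simp at hv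
  have hrv : ∀ x, lorentzBilin n v (r x) = -lorentzBilin n v x := fun x => by
    rw [hrx, map_sub, map_smul, lorentzBilin_self, smul_eq_mul]
    field_simp
    ring
  have hrr : Function.Involutive r := fun x => by
    rw [hrx (r x), hrv, hrx]
    module
  have hrQ : ∀ x, lorentzForm n (r x) = lorentzForm n x := fun x => by
    rw [hrx, sub_eq_add_neg, ← neg_smul, lorentzForm_add, lorentzForm_smul, map_smul,
      lorentzBilin_comm x v, smul_eq_mul]
    field_simp
    ring
  refine ⟨LinearEquiv.ofInvolutive r hrr, ?_, fun x => ?_, ?_⟩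
  · refine mem_orthochronous_of_map_mem hrQ timeVector_mem_hyperboloid
      ⟨(hrQ _).trans lorentzForm_timeVector, ?_⟩
    change 0 < r (timeVector n) (Fin.last n)
    rw [hrx, lorentzBilin_timeVector, Pi.sub_apply, timeVector_last, Pi.smul_apply, smul_eq_mul]
    have : 0 ≤ 2 / lorentzForm n v * (v (Fin.last n) * v (Fin.last n)) :=
      mul_nonneg (by positivity) (mul_self_nonneg _)
    linarith
  · change r (T x) = T (r x)
    have h1 := lorentzBilin_map_of_mem hT v x
    rw [hrx, hrx, map_sub, map_smul]
    rcases hTv with hTv | hTv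
    · rw [hTv] at h1 ⊢
      rw [h1]
    · rw [hTv] at h1 ⊢
      rw [← h1, map_neg, LinearMap.neg_apply, smul_neg, mul_neg, neg_smul, neg_neg]
  · have hker : LinearMap.ker (r + 1) = Submodule.span ℝ {v} := by
      ext x
      rw [LinearMap.mem_ker, Submodule.mem_span_singleton, LinearMap.add_apply, hrx,
        Module.End.one_apply]
      constructor
      · intro hx
        refine ⟨lorentzBilin n v x / lorentzForm n v, ?_⟩
        have : (2 : ℝ) • (x - (lorentzBilin n v x / lorentzForm n v) • v) = 0 := by
          rw [← hx]; module
        exact (sub_eq_zero.1 ((smul_eq_zero.1 this).resolve_left two_ne_zero)).symm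
      · rintro ⟨c, rfl⟩
        rw [map_smul, lorentzBilin_self, smul_eq_mul]
        have : 2 / lorentzForm n v * (c * lorentzForm n v) = 2 * c := by field_simp
        rw [this]
        module
    change LinearMap.det r = -1
    rw [LinearMap.det_of_comp_self_eq_id hrr, hker, finrank_span_singleton hv0, pow_one]

/-- The criterion behind all three parts: without a space-like eigenvector for `±1`, every
reversing isometry has determinant `(-1) ^ ⌊(n + 1) / 2⌋`; with one, the sign can be changed. -/
theorem isRealElement_iff (T : SOo n) : IsRealElement T ↔
    Even ((n + 1) / 2) ∨
      HasSpacelikeUnitEigenvector (T : (Fin (n + 1) → ℝ) ≃ₗ[ℝ] (Fin (n + 1) → ℝ)) := by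
  obtain ⟨T, hTS⟩ := T
  obtain ⟨hT, hdT⟩ := mem_SOo_iff.1 hTS
  obtain ⟨S, hS, hSS, hST⟩ := exists_involution_reversing hT
  have hreal : ∀ U ∈ orthochronous n, (∀ x, U (T x) = T.symm (U x)) →
      LinearMap.det (U : (Fin (n + 1) → ℝ) →ₗ[ℝ] (Fin (n + 1) → ℝ)) = 1 →
      IsRealElement (⟨T, hTS⟩ : SOo n) := by
    intro U hU hUT hdU
    refine ⟨⟨U, mem_SOo_iff.2 ⟨hU, hdU⟩⟩, mul_inv_eq_iff_eq_mul.2 (Subtype.ext ?_)⟩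
    exact LinearEquiv.ext hUT
  constructor
  · rintro ⟨⟨U, hUS⟩, hU⟩
    by_cases h : HasSpacelikeUnitEigenvector T
    · exact Or.inr h
    refine Or.inl ?_
    obtain ⟨hU', hdU⟩ := mem_SOo_iff.1 hUS
    have hUT : ∀ x, U (T x) = T.symm (U x) := fun x =>
      LinearEquiv.congr_fun (congrArg Subtype.val (mul_inv_eq_iff_eq_mul.1 hU)) x
    have h1 := det_eq_one_of_commute hT h ((orthochronous n).mul_mem hU' hS) (fun x => by
      have h2 : U (T.symm (S x)) = T (U (S x)) := by
        have := hUT (T.symm (S x))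
        rw [T.apply_symm_apply] at this
        rw [this, T.apply_symm_apply]
      rw [LinearEquiv.mul_apply, LinearEquiv.mul_apply, hST, h2])
    have h2 : ((U * S : (Fin (n + 1) → ℝ) ≃ₗ[ℝ] (Fin (n + 1) → ℝ)) :
      (Fin (n + 1) → ℝ) →ₗ[ℝ] (Fin (n + 1) → ℝ)) = U.toLinearMap ∘ₗ S.toLinearMap := rfl
    rw [h2, LinearMap.det_comp, hdU, one_mul, det_of_reversing_involution hT h hS hSS hST] at h1
    exact (neg_one_pow_eq_one_iff_even (by norm_num)).1 h1
  · intro h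
    have hsq : LinearMap.det S.toLinearMap = 1 ∨ LinearMap.det S.toLinearMap = -1 := by
      rw [LinearMap.det_of_comp_self_eq_id (σ := S.toLinearMap) hSS]
      exact neg_one_pow_eq_or ℝ _
    rcases hsq with h1 | h1
    · exact hreal S hS hST h1
    by_cases hs : HasSpacelikeUnitEigenvector T
    · obtain ⟨r, hr, hrT, hdr⟩ := exists_reflection_commute hT hs
      refine hreal (S * r) ((orthochronous n).mul_mem hS hr) (fun x => ?_) ?_
      · rw [LinearEquiv.mul_apply, LinearEquiv.mul_apply, hrT, hST]
      · have h2 : ((S * r : (Fin (n + 1) → ℝ) ≃ₗ[ℝ] (Fin (n + 1) → ℝ)) :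
          (Fin (n + 1) → ℝ) →ₗ[ℝ] (Fin (n + 1) → ℝ)) = S.toLinearMap ∘ₗ r.toLinearMap := rfl
        rw [h2, LinearMap.det_comp, h1]
        exact (congrArg (fun d => -1 * d) hdr).trans (by norm_num)
    · refine hreal S hS hST ?_
      rw [det_of_reversing_involution hT hs hS hSS hST, (h.resolve_right hs).neg_one_pow]

end Master

/-! ### Kernel of the skew part and parity of the dimension -/

section Parity

open Module

variable {n : ℕ} {T : (Fin (n + 1) → ℝ) ≃ₗ[ℝ] (Fin (n + 1) → ℝ)}

theorem exists_skewPart_eq_zero_of_even (hT : T ∈ orthochronous n) (hn : Even n) :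
    ∃ x, x ≠ 0 ∧ skewPart T x = 0 := by
  by_contra! h
  have heven := LinearMap.BilinForm.even_finrank_of_alternating
    (ω := (lorentzBilin n) ∘ₗ skewPart T) (lorentzBilin_skewPart hT) ⊤ fun x _ hx => by
      by_contra h0
      exact h x h0 (lorentzBilin_nondegenerate.1 _ fun y => hx y trivial)
  rw [finrank_top, finrank_fin_fun] at heven
  exact (Nat.not_even_iff_odd.2 hn.add_one) heven

/-- If the kernel of `T - T⁻¹` were a causal line, its skew form would be nondegenerate on the
complementary hyperplane `xₙ = 0`, which has odd dimension `n`. -/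
theorem hasSpacelikeUnitEigenvector_of_odd (hT : T ∈ orthochronous n) (hn : Odd n)
    {z : Fin (n + 1) → ℝ} (hz : z ≠ 0) (hTz : skewPart T z = 0) :
    HasSpacelikeUnitEigenvector T := by
  by_contra hno
  have hl : z (Fin.last n) ≠ 0 := fun h => hz (eq_zero_of_skewPart_eq_zero_of_last_eq_zero hT hno hTz h)
  set p : (Fin (n + 1) → ℝ) →ₗ[ℝ] ℝ := LinearMap.proj (Fin.last n) with hp
  have heven := LinearMap.BilinForm.even_finrank_of_alternating
    (ω := (lorentzBilin n) ∘ₗ skewPart T) (lorentzBilin_skewPart hT) (LinearMap.ker p)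
    fun x hx h => by
      refine eq_zero_of_skewPart_eq_zero_of_last_eq_zero hT hno (lorentzBilin_nondegenerate.1 _ fun y => ?_) hx
      have h1 := h (y - (y (Fin.last n) / z (Fin.last n)) • z) (by simp [hp, hl])
      have h2 : lorentzBilin n (skewPart T x) z = 0 := by
        rw [lorentzBilin_skewPart hT, hTz, map_zero, LinearMap.zero_apply, neg_zero]
      rw [LinearMap.comp_apply, map_sub, map_smul, h2, smul_zero, sub_zero] at h1
      exact h1
  have hrange : LinearMap.range p = ⊤ :=
    LinearMap.range_eq_top.2 (LinearMap.proj_surjective (Fin.last n))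
  have hdim := LinearMap.finrank_range_add_finrank_ker p
  rw [hrange, finrank_top, finrank_self, finrank_fin_fun] at hdim
  have : finrank ℝ (LinearMap.ker p) = n := by omega
  rw [this] at heven
  exact (Nat.not_even_iff_odd.2 hn) heven

end Parity

/-! ### Hyperbolic isometries -/

section Hyperbolic

variable {n : ℕ}

theorem exists_eigenvector_of_map_eq {T : SOo n} {L : Submodule ℝ (Fin (n + 1) → ℝ)}
    (hL : L ∈ conformalBoundary n) (hTL : L.map (lorentzEnd T) = L) :
    ∃ (v : Fin (n + 1) → ℝ) (c : ℝ), v ≠ 0 ∧ lorentzForm n v = 0 ∧ L = Submodule.span ℝ {v} ∧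
      T.1 v = c • v := by
  obtain ⟨v, hv0, hv, rfl⟩ := hL
  have : lorentzEnd T v ∈ Submodule.span ℝ {v} :=
    hTL.le (Submodule.mem_map_of_mem (Submodule.mem_span_singleton_self v))
  obtain ⟨c, hc⟩ := Submodule.mem_span_singleton.1 this
  exact ⟨v, c, hv0, hv, rfl, hc.symm⟩

theorem span_mem_fixed {T : SOo n} {v : Fin (n + 1) → ℝ} {c : ℝ} (hv0 : v ≠ 0)
    (hv : lorentzForm n v = 0) (hc : c ≠ 0) (hTv : T.1 v = c • v) :
    Submodule.span ℝ {v} ∈ {L ∈ conformalBoundary n | L.map (lorentzEnd T) = L} := by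
  refine ⟨⟨v, hv0, hv, rfl⟩, ?_⟩
  have h : lorentzEnd T v = c • v := hTv
  rw [Submodule.map_span, Set.image_singleton, h,
    Submodule.span_singleton_smul_eq (IsUnit.mk0 c hc)]

theorem eq_span_of_mem_span {v w : Fin (n + 1) → ℝ} (hw : w ≠ 0)
    (h : w ∈ Submodule.span ℝ {v}) : Submodule.span ℝ {w} = Submodule.span ℝ {v} := by
  obtain ⟨c, rfl⟩ := Submodule.mem_span_singleton.1 h
  have hc : c ≠ 0 := by rintro rfl; simp at hw
  exact Submodule.span_singleton_smul_eq (IsUnit.mk0 c hc) v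

/-- A causal eigenvector of `T` for `±1` spans, together with a second fixed light-like line, a
plane that contains a fixed time-like vector. -/
theorem IsHyperbolic.lorentzForm_pos {T : SOo n} (hT : IsHyperbolic T) {v : Fin (n + 1) → ℝ}
    (hv0 : v ≠ 0) (hv : T.1 v = v ∨ T.1 v = -v) : 0 < lorentzForm n v := by
  have hT' := (mem_SOo_iff.1 T.2).1
  rcases hv with hv | hv
  swap
  · exact lorentzForm_pos_of_map_eq_neg hT' hv hv0
  have hfix : ∀ x, T.1 x = x → 0 ≤ lorentzForm n x := by
    intro x hx
    by_contra hneg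
    obtain ⟨c, hc⟩ := exists_smul_mem_hyperboloid (not_le.1 hneg)
    exact hT.1 _ hc (by rw [map_smul]; exact congrArg (c • ·) hx)
  refine lt_of_le_of_ne (hfix v hv) fun hQ => ?_
  obtain ⟨L₁, L₂, hne, hset⟩ := Set.ncard_eq_two.1 hT.2
  obtain ⟨L, hL, hLv⟩ : ∃ L ∈ {L ∈ conformalBoundary n | L.map (lorentzEnd T) = L},
      L ≠ Submodule.span ℝ {v} := by
    rw [hset]
    by_cases h : L₁ = Submodule.span ℝ {v}
    · exact ⟨L₂, by simp, fun h' => hne (h.trans h'.symm)⟩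
    · exact ⟨L₁, by simp, h⟩
  obtain ⟨w, b, hw0, hw, rfl, hTw⟩ := exists_eigenvector_of_map_eq hL.1 hL.2
  have hB := lorentzBilin_ne_zero_of_lightlike hQ.symm hw hv0
    fun h => hLv (eq_span_of_mem_span hw0 h)
  have hb : b = 1 := by
    have := lorentzBilin_map_of_mem hT' v w
    rw [hv, hTw, map_smul, smul_eq_mul] at this
    exact mul_right_cancel₀ hB (by rw [this, one_mul])
  have h := hfix (v + (-lorentzBilin n v w) • w) (by
    rw [map_add, map_smul, hv, hTw, hb, one_smul])
  rw [lorentzForm_add, lorentzForm_smul, hw, ← hQ, map_smul, smul_eq_mul] at h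
  nlinarith [sq_nonneg (lorentzBilin n v w), pow_pos (abs_pos.2 hB) 2, sq_abs (lorentzBilin n v w)]

theorem lorentzBilin_single (x : Fin (n + 1) → ℝ) (j : Fin (n + 1)) :
    lorentzBilin n x (Pi.single j 1) = (if j = Fin.last n then -1 else 1) * x j := by
  refine Fin.lastCases ?_ (fun j => ?_) j
  · simpa [timeVector] using lorentzBilin_timeVector x
  · simp [lorentzBilin_apply, Fin.castSucc_ne_last, Pi.single_apply]

/-- Multiplying `T - T⁻¹` by the Gram matrix, of determinant `-1`, gives a skew matrix. -/
theorem det_skewPart_neg {T : (Fin (n + 1) → ℝ) ≃ₗ[ℝ] (Fin (n + 1) → ℝ)}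
    (hT : T ∈ orthochronous n) (hinj : ∀ x, skewPart T x = 0 → x = 0) :
    LinearMap.det (skewPart T) < 0 := by
  set G : Matrix (Fin (n + 1)) (Fin (n + 1)) ℝ :=
    Matrix.diagonal fun i => if i = Fin.last n then -1 else 1 with hG
  have hdetG : G.det = -1 := by
    simp [hG, Matrix.det_diagonal]
  have hdet : LinearMap.det (skewPart T) ≠ 0 := by
    rw [Ne, LinearMap.det_eq_zero_iff_ker_ne_bot, not_not]
    exact LinearMap.ker_eq_bot'.2 hinj
  have hskew : (G * LinearMap.toMatrix' (skewPart T)).transpose =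
      -(G * LinearMap.toMatrix' (skewPart T)) := by
    ext i j
    have := lorentzBilin_skewPart hT (Pi.single i 1) (Pi.single j 1)
    rw [lorentzBilin_single, lorentzBilin_single] at this
    simpa [hG, Matrix.diagonal_mul, LinearMap.toMatrix'_apply] using this
  have hmul : (G * LinearMap.toMatrix' (skewPart T)).det = -LinearMap.det (skewPart T) := by
    rw [Matrix.det_mul, hdetG, LinearMap.det_toMatrix', neg_one_mul]
  have := Matrix.det_pos_of_skew hskew (by rw [hmul]; exact neg_ne_zero.2 hdet)
  rw [hmul] at this
  linarith

theorem lorentzForm_eq_zero_of_eigenvector {T : (Fin (n + 1) → ℝ) ≃ₗ[ℝ] (Fin (n + 1) → ℝ)}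
    (hT : T ∈ orthochronous n) {v : Fin (n + 1) → ℝ} {c : ℝ} (hv : T v = c • v)
    (hc : c ^ 2 ≠ 1) : lorentzForm n v = 0 := by
  have h := hT.1 v
  rw [hv, lorentzForm_smul] at h
  have : (c ^ 2 - 1) * lorentzForm n v = 0 := by linarith
  exact (mul_eq_zero.1 this).resolve_left (sub_ne_zero.2 hc)

/-- The product of the values of the characteristic polynomial of `T` at `1` and `-1` is
`det (T - T⁻¹) < 0`, so that `T` has an eigenvalue `l ∈ (-1, 1)`; its inverse is one too. -/
theorem isHyperbolic_of_skewPart_injective {T : SOo n}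
    (hinj : ∀ x, skewPart T.1 x = 0 → x = 0) : IsHyperbolic T := by
  obtain ⟨hT, hdT⟩ := mem_SOo_iff.1 T.2
  refine ⟨fun x hx hTx => ?_, ?_⟩
  · have h0 := hinj x (skewPart_eq_zero_of_eigenvector (Or.inl hTx))
    have := hx.2
    simp [h0] at this
  set F : ℝ → ℝ := fun t =>
    LinearMap.det (T.1.toLinearMap - t • (1 : Module.End ℝ (Fin (n + 1) → ℝ))) with hF
  have hFc : Continuous F := by
    have : F = fun t => (LinearMap.toMatrix' T.1.toLinearMap - t • 1).det := by
      funext t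
      rw [hF]
      simp only
      rw [← LinearMap.det_toMatrix', map_sub, map_smul, LinearMap.toMatrix'_one]
    rw [this]
    apply Continuous.matrix_det
    fun_prop
  have hprod : F 1 * F (-1) < 0 := by
    have h1 : (T.1.toLinearMap - (1 : ℝ) • (1 : Module.End ℝ (Fin (n + 1) → ℝ))) ∘ₗ
        (T.1.toLinearMap - (-1 : ℝ) • (1 : Module.End ℝ (Fin (n + 1) → ℝ))) =
        T.1.toLinearMap ∘ₗ skewPart T.1 := by
      refine LinearMap.ext fun x => ?_
      simp [skewPart_apply]
      abel
    simp only [hF]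
    rw [← LinearMap.det_comp, h1, LinearMap.det_comp, hdT, one_mul]
    exact det_skewPart_neg hT hinj
  obtain ⟨l, hl, hFl⟩ : ∃ l ∈ Set.Icc (-1 : ℝ) 1, F l = 0 := by
    rcases mul_neg_iff.1 hprod with ⟨h1, h2⟩ | ⟨h1, h2⟩
    · exact intermediate_value_Icc (by norm_num) hFc.continuousOn ⟨h2.le, h1.le⟩
    · exact intermediate_value_Icc' (by norm_num) hFc.continuousOn ⟨h1.le, h2.le⟩
  have hl2 : l ^ 2 ≠ 1 := by
    intro h
    rcases mul_self_eq_one_iff.1 ((sq l).symm.trans h) with h | h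
    · rw [h] at hFl; simp [hFl] at hprod
    · rw [h] at hFl; simp [hFl] at hprod
  obtain ⟨u, hu0, hu⟩ := LinearMap.exists_apply_eq_smul_of_det_eq_zero hFl
  replace hu : T.1 u = l • u := hu
  have hl0 : l ≠ 0 := by
    rintro rfl
    exact hu0 (T.1.map_eq_zero_iff.1 (by rw [hu, zero_smul]))
  have hFl' : LinearMap.det (T.1.symm.toLinearMap -
      l • (1 : Module.End ℝ (Fin (n + 1) → ℝ))) = 0 := by
    refine (LinearMap.BilinForm.det_eq_of_adjoint lorentzBilin_nondegenerate
      fun x y => ?_).symm.trans hFl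
    simp [lorentzBilin_symm_right hT]
  obtain ⟨w, hw0, hw⟩ := LinearMap.exists_apply_eq_smul_of_det_eq_zero hFl'
  replace hw : T.1 w = l⁻¹ • w := by
    have h1 : T.1.symm w = l • w := hw
    have h2 : w = l • T.1 w := by rw [← map_smul, ← h1, T.1.apply_symm_apply]
    nth_rewrite 2 [h2]
    rw [smul_smul, inv_mul_cancel₀ hl0, one_smul]
  have hl2' : l⁻¹ ^ 2 ≠ 1 := by rwa [inv_pow, Ne, inv_eq_one]
  have hQu := lorentzForm_eq_zero_of_eigenvector hT hu hl2
  have hQw := lorentzForm_eq_zero_of_eigenvector hT hw hl2'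
  -- Light-like eigenvectors on different lines have a nonzero product, so inverse eigenvalues.
  have hmul : ∀ {x y : Fin (n + 1) → ℝ} {a b : ℝ}, x ≠ 0 → y ≠ 0 → lorentzForm n x = 0 →
      lorentzForm n y = 0 → T.1 x = a • x → T.1 y = b • y →
      Submodule.span ℝ {y} ≠ Submodule.span ℝ {x} → a * b = 1 := by
    intro x y a b hx0 hy0 hx hy hTx hTy hne
    have hB := lorentzBilin_ne_zero_of_lightlike hx hy hx0 fun h => hne (eq_span_of_mem_span hy0 h)
    have := lorentzBilin_map_of_mem hT x y
    rw [hTx, hTy, map_smul, map_smul, LinearMap.smul_apply, smul_eq_mul, smul_eq_mul,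
      ← mul_assoc] at this
    rw [mul_comm]
    exact mul_right_cancel₀ hB (by rw [this, one_mul])
  have hne : Submodule.span ℝ {u} ≠ Submodule.span ℝ {w} := by
    intro h
    obtain ⟨c, rfl⟩ := Submodule.mem_span_singleton.1
      (h ▸ Submodule.mem_span_singleton_self u : u ∈ Submodule.span ℝ {w})
    rw [map_smul, hw, smul_comm] at hu
    have := smul_left_injective ℝ hu0 hu
    apply hl2
    rw [sq]
    nth_rewrite 1 [← this]
    exact inv_mul_cancel₀ hl0
  have hset : {L ∈ conformalBoundary n | L.map (lorentzEnd T) = L} =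
      {Submodule.span ℝ {u}, Submodule.span ℝ {w}} := by
    refine Set.Subset.antisymm (fun L hL => ?_) ?_
    · obtain ⟨z, c, hz0, hz, rfl, hTz⟩ := exists_eigenvector_of_map_eq hL.1 hL.2
      by_contra hnot
      simp only [Set.mem_insert_iff, Set.mem_singleton_iff, not_or] at hnot
      have h1 := hmul hu0 hz0 hQu hz hu hTz hnot.1
      have h2 := hmul hw0 hz0 hQw hz hw hTz hnot.2
      have h3 : c = l := by
        have := congrArg (l * ·) h2
        simpa [← mul_assoc, hl0] using this
      exact hl2 (by rw [sq]; nth_rewrite 2 [← h3]; exact h1)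
    · rintro L (rfl | rfl)
      · exact span_mem_fixed hu0 hQu hl0 hu
      · exact span_mem_fixed hw0 hQw (inv_ne_zero hl0) hw
  rw [hset, Set.ncard_pair hne]

end Hyperbolic

/-! ### Isometries without space-like eigenvectors for `±1` -/

section Examples

theorem exists_SOo_of_linearMap {n : ℕ} (f : (Fin (n + 1) → ℝ) →ₗ[ℝ] (Fin (n + 1) → ℝ))
    (hQ : ∀ x, lorentzForm n (f x) = lorentzForm n x)
    (he : 0 < f (timeVector n) (Fin.last n))
    (hno : ∀ v, (f v = v ∨ f v = -v) → lorentzForm n v ≤ 0) :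
    ∃ T : SOo n, ¬ HasSpacelikeUnitEigenvector T.1 := by
  have hinj : Function.Injective f := by
    refine (injective_iff_map_eq_zero f).2 fun x hx => lorentzBilin_nondegenerate.1 _ fun y => ?_
    rw [← lorentzBilin_map hQ, hx, map_zero, LinearMap.zero_apply]
  set T := LinearEquiv.ofInjectiveEndo f hinj
  have hT : T ∈ orthochronous n := mem_orthochronous_of_map_mem hQ timeVector_mem_hyperboloid
    ⟨(hQ _).trans lorentzForm_timeVector, he⟩
  have hTno : ¬ HasSpacelikeUnitEigenvector T := fun ⟨v, hv, hTv⟩ => not_lt.2 (hno v hTv) hv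
  refine ⟨⟨T, mem_SOo_iff.2 ⟨hT, ?_⟩⟩, hTno⟩
  refine LinearMap.BilinForm.det_eq_one_of_isometry lorentzBilin_nondegenerate
    (lorentzBilin_map_of_mem hT) fun v hv => ?_
  by_contra hv0
  exact hTno ⟨v, lorentzForm_pos_of_map_eq_neg hT hv hv0, Or.inr hv⟩

/-- Signs and a pairing of the coordinates such that `x ↦ (i ↦ s i * x (τ i))` is a quarter turn
in each of the `m` planes. -/
theorem exists_pairing (m : ℕ) : ∃ (τ : Equiv.Perm (Fin (m * 2))) (s : Fin (m * 2) → ℝ),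
    (∀ i, τ (τ i) = i) ∧ (∀ i, s i ^ 2 = 1) ∧ ∀ i, s (τ i) = -s i := by
  refine ⟨(finProdFinEquiv.symm.trans ((Equiv.refl _).prodCongr (Equiv.swap 0 1))).trans
    finProdFinEquiv, fun i => if (finProdFinEquiv.symm i).2 = 0 then 1 else -1, ?_, ?_, ?_⟩
  · intro i
    obtain ⟨⟨a, b⟩, rfl⟩ := finProdFinEquiv.surjective i
    simp
  · intro i
    simp only
    split_ifs <;> norm_num
  · intro i
    obtain ⟨⟨a, b⟩, rfl⟩ := finProdFinEquiv.surjective i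
    fin_cases b <;> simp

theorem eq_zero_of_quarter_turn {m : ℕ} {τ : Equiv.Perm (Fin (m * 2))} {s : Fin (m * 2) → ℝ}
    (hτ : ∀ i, τ (τ i) = i) (hs : ∀ i, s i ^ 2 = 1) (hsτ : ∀ i, s (τ i) = -s i)
    {y : Fin (m * 2) → ℝ} {c : ℝ} (hy : ∀ i, s i * y (τ i) = c * y i) (hc : c ^ 2 = 1) :
    y = 0 := by
  funext i
  have h1 := hy i
  have h2 := hy (τ i)
  rw [hτ, hsτ] at h2
  have h3 : c ^ 2 * y i = -(s i ^ 2 * y i) := by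
    linear_combination (-c) * h1 - s i * h2
  rw [hc, hs] at h3
  simp only [Pi.zero_apply]
  linarith

theorem exists_not_hasSpacelikeUnitEigenvector_even (m : ℕ) :
    ∃ T : SOo (m * 2), ¬ HasSpacelikeUnitEigenvector T.1 := by
  obtain ⟨τ, s, hτ, hs, hsτ⟩ := exists_pairing m
  let f : (Fin (m * 2 + 1) → ℝ) →ₗ[ℝ] (Fin (m * 2 + 1) → ℝ) :=
    { toFun := fun x => Fin.snoc (α := fun _ => ℝ)
        (fun i => s i * x (τ i).castSucc) (x (Fin.last _))
      map_add' := fun x y => by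
        funext i
        refine Fin.lastCases ?_ (fun j => ?_) i <;> simp [mul_add]
      map_smul' := fun c x => by
        funext i
        refine Fin.lastCases ?_ (fun j => ?_) i <;> simp [mul_left_comm] }
  have hf1 : ∀ x i, f x (Fin.castSucc i) = s i * x (τ i).castSucc := fun x i => by simp [f]
  have hf2 : ∀ x, f x (Fin.last _) = x (Fin.last _) := fun x => by simp [f]
  refine exists_SOo_of_linearMap f (fun x => ?_) (by rw [hf2, timeVector_last]; exact one_pos)
    fun v hv => ?_
  · rw [lorentzForm_apply, lorentzForm_apply, hf2,
      ← Equiv.sum_comp τ fun i => x (Fin.castSucc i) ^ 2]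
    simp only [hf1, mul_pow, hs, one_mul]
  · obtain ⟨c, hc, hcv⟩ : ∃ c : ℝ, c ^ 2 = 1 ∧ f v = c • v := by
      rcases hv with h | h
      · exact ⟨1, by norm_num, by simpa using h⟩
      · exact ⟨-1, by norm_num, by simpa using h⟩
    have h0 := eq_zero_of_quarter_turn hτ hs hsτ (y := fun i => v i.castSucc)
      (fun i => by rw [← hf1, hcv]; rfl) hc
    rw [lorentzForm_apply]
    have : ∀ i : Fin (m * 2), v i.castSucc = 0 := fun i => congrFun h0 i
    simp [this, sq_nonneg]

theorem exists_not_hasSpacelikeUnitEigenvector_odd (m : ℕ) :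
    ∃ T : SOo (m * 2 + 1), ¬ HasSpacelikeUnitEigenvector T.1 := by
  obtain ⟨τ, s, hτ, hs, hsτ⟩ := exists_pairing m
  -- The last two coordinates are moved by the boost with entries `5/4` and `3/4`.
  let f : (Fin (m * 2 + 1 + 1) → ℝ) →ₗ[ℝ] (Fin (m * 2 + 1 + 1) → ℝ) :=
    { toFun := fun x => Fin.snoc (α := fun _ => ℝ)
        (Fin.snoc (α := fun _ => ℝ) (fun i => s i * x (τ i).castSucc.castSucc)
          (5 / 4 * x (Fin.last _).castSucc + 3 / 4 * x (Fin.last _)))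
        (3 / 4 * x (Fin.last _).castSucc + 5 / 4 * x (Fin.last _))
      map_add' := fun x y => by
        funext i
        refine Fin.lastCases ?_ (fun j => ?_) i
        · simp; ring
        · refine Fin.lastCases ?_ (fun k => ?_) j
          · simp; ring
          · simp [mul_add]
      map_smul' := fun c x => by
        funext i
        refine Fin.lastCases ?_ (fun j => ?_) i
        · simp; ring
        · refine Fin.lastCases ?_ (fun k => ?_) j
          · simp; ring
          · simp [mul_left_comm] }
  have hf1 : ∀ x (i : Fin (m * 2)),
      f x i.castSucc.castSucc = s i * x (τ i).castSucc.castSucc := fun x i => by simp [f]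
  have hf2 : ∀ x, f x (Fin.last _).castSucc =
      5 / 4 * x (Fin.last _).castSucc + 3 / 4 * x (Fin.last _) := fun x => by simp [f]
  have hf3 : ∀ x, f x (Fin.last _) =
      3 / 4 * x (Fin.last _).castSucc + 5 / 4 * x (Fin.last _) := fun x => by simp [f]
  refine exists_SOo_of_linearMap f (fun x => ?_) ?_ fun v hv => ?_
  · rw [lorentzForm_apply, lorentzForm_apply, Fin.sum_univ_castSucc, Fin.sum_univ_castSucc, hf2,
      hf3, ← Equiv.sum_comp τ fun i => x (Fin.castSucc (Fin.castSucc i)) ^ 2]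
    simp only [hf1, mul_pow, hs, one_mul]
    ring
  · rw [hf3, timeVector_last, timeVector_castSucc]
    norm_num
  · obtain ⟨c, hc, hcv⟩ : ∃ c : ℝ, c ^ 2 = 1 ∧ f v = c • v := by
      rcases hv with h | h
      · exact ⟨1, by norm_num, by simpa using h⟩
      · exact ⟨-1, by norm_num, by simpa using h⟩
    have h0 := eq_zero_of_quarter_turn hτ hs hsτ (y := fun i => v i.castSucc.castSucc)
      (fun i => by rw [← hf1, hcv]; rfl) hc
    have h1 : ∀ i : Fin (m * 2), v i.castSucc.castSucc = 0 := fun i => congrFun h0 i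
    have h2 := hf2 v
    have h3 := hf3 v
    rw [hcv, Pi.smul_apply, smul_eq_mul] at h2 h3
    have h4 : v (Fin.last _).castSucc = 0 := by
      rcases mul_self_eq_one_iff.1 ((sq c).symm.trans hc) with rfl | rfl <;> linarith
    rw [lorentzForm_apply, Fin.sum_univ_castSucc]
    simp [h1, h4, sq_nonneg]

theorem exists_not_hasSpacelikeUnitEigenvector (n : ℕ) :
    ∃ T : SOo n, ¬ HasSpacelikeUnitEigenvector T.1 := by
  rcases Nat.even_or_odd' n with ⟨m, rfl | rfl⟩
  · rw [mul_comm]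
    exact exists_not_hasSpacelikeUnitEigenvector_even m
  · rw [mul_comm]
    exact exists_not_hasSpacelikeUnitEigenvector_odd m

end Examples

theorem hasEigenvalue_iff_exists {n : ℕ} (T : SOo n) (c : ℝ) :
    (lorentzEnd T).HasEigenvalue c ↔ ∃ v, v ≠ 0 ∧ T.1 v = c • v := by
  constructor
  · intro h
    obtain ⟨v, hv⟩ := h.exists_hasEigenvector
    exact ⟨v, hv.2, hv.apply_eq_smul⟩
  · rintro ⟨v, hv0, hv⟩
    exact Module.End.hasEigenvalue_of_hasEigenvector
      (x := v) ⟨Module.End.mem_eigenspace_iff.2 hv, hv0⟩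

/-! ### The classification of real elements -/

theorem theorem1p1 (n : ℕ) :
    ((∀ T : SOo n, IsRealElement T) ↔ (n ≡ 0 [MOD 4] ∨ n ≡ 3 [MOD 4])) ∧
    (n ≡ 1 [MOD 4] → ∀ T : SOo n,
      IsRealElement T ↔
        ((IsHyperbolic T ∧ ((lorentzEnd T).HasEigenvalue 1 ∨ (lorentzEnd T).HasEigenvalue (-1))) ∨
          ¬ IsHyperbolic T)) ∧
    (n ≡ 2 [MOD 4] → ∀ T : SOo n,
      IsRealElement T ↔
        (IsHyperbolic T ∨
          (¬ IsHyperbolic T ∧ (lorentzEnd T).HasEigenvalue (-1)) ∨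
          (¬ IsHyperbolic T ∧ ¬ (lorentzEnd T).HasEigenvalue (-1) ∧
            ∃ v, (lorentzEnd T).HasEigenvector 1 v ∧ 0 < lorentzForm n v))) := by
  have hne : ∀ {v : Fin (n + 1) → ℝ}, 0 < lorentzForm n v → v ≠ 0 := by
    rintro v hv rfl
    simp at hv
  have hdim : Even ((n + 1) / 2) ↔ (n ≡ 0 [MOD 4] ∨ n ≡ 3 [MOD 4]) := by
    rw [Nat.even_iff, Nat.ModEq, Nat.ModEq]
    omega
  have hpm : ∀ {T : SOo n} {v : Fin (n + 1) → ℝ} {c : ℝ}, c = 1 ∨ c = -1 → T.1 v = c • v →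
      T.1 v = v ∨ T.1 v = -v := by
    rintro T v c (rfl | rfl) h
    · exact Or.inl (by simpa using h)
    · exact Or.inr (by simpa using h)
  refine ⟨?_, fun hn T => ?_, fun hn T => ?_⟩
  · rw [← hdim]
    refine ⟨fun h => ?_, fun h T => (isRealElement_iff T).2 (Or.inl h)⟩
    obtain ⟨T, hT⟩ := exists_not_hasSpacelikeUnitEigenvector n
    exact ((isRealElement_iff T).1 (h T)).resolve_right hT
  · have hodd : ¬ Even ((n + 1) / 2) := by
      rw [Nat.even_iff]; rw [Nat.ModEq] at hn; omega
    have hn' : Odd n := by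
      rw [Nat.odd_iff]; rw [Nat.ModEq] at hn; omega
    rw [isRealElement_iff, or_iff_right hodd]
    constructor
    · rintro ⟨v, hv, hTv⟩
      by_cases hT : IsHyperbolic T
      · refine Or.inl ⟨hT, hTv.imp (fun h => ?_) fun h => ?_⟩
        · exact (hasEigenvalue_iff_exists T 1).2 ⟨v, hne hv, by rwa [one_smul]⟩
        · exact (hasEigenvalue_iff_exists T (-1)).2 ⟨v, hne hv, by rwa [neg_one_smul]⟩
      · exact Or.inr hT
    · rintro (⟨hT, hev⟩ | hT)
      · obtain ⟨v, hv0, hv⟩ : ∃ v, v ≠ 0 ∧ (T.1 v = v ∨ T.1 v = -v) := by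
          rcases hev with h | h
          · obtain ⟨v, hv0, hv⟩ := (hasEigenvalue_iff_exists T 1).1 h
            exact ⟨v, hv0, hpm (Or.inl rfl) hv⟩
          · obtain ⟨v, hv0, hv⟩ := (hasEigenvalue_iff_exists T (-1)).1 h
            exact ⟨v, hv0, hpm (Or.inr rfl) hv⟩
        exact ⟨v, hT.lorentzForm_pos hv0 hv, hv⟩
      · by_contra hno
        refine hT (isHyperbolic_of_skewPart_injective fun x hx => ?_)
        by_contra hx0
        exact hno (hasSpacelikeUnitEigenvector_of_odd (mem_SOo_iff.1 T.2).1 hn' hx0 hx)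
  · have hodd : ¬ Even ((n + 1) / 2) := by
      rw [Nat.even_iff]; rw [Nat.ModEq] at hn; omega
    have hn' : Even n := by
      rw [Nat.even_iff]; rw [Nat.ModEq] at hn; omega
    rw [isRealElement_iff, or_iff_right hodd]
    have hT' := (mem_SOo_iff.1 T.2).1
    constructor
    · rintro ⟨v, hv, hTv⟩
      by_cases hT : IsHyperbolic T
      · exact Or.inl hT
      by_cases hev : (lorentzEnd T).HasEigenvalue (-1)
      · exact Or.inr (Or.inl ⟨hT, hev⟩)
      refine Or.inr (Or.inr ⟨hT, hev, v, ⟨Module.End.mem_eigenspace_iff.2 ?_, hne hv⟩, hv⟩)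
      rcases hTv with h | h
      · exact h.trans (one_smul ℝ v).symm
      · exact absurd ((hasEigenvalue_iff_exists T (-1)).2 ⟨v, hne hv, by rwa [neg_one_smul]⟩) hev
    · rintro (hT | ⟨-, hev⟩ | ⟨-, -, v, hv, hQ⟩)
      · obtain ⟨x, hx0, hx⟩ := exists_skewPart_eq_zero_of_even hT' hn'
        obtain ⟨v, hv0, hv⟩ := exists_eigenvector_of_skewPart_eq_zero hx0 hx
        exact ⟨v, hT.lorentzForm_pos hv0 hv, hv⟩
      · obtain ⟨v, hv0, hv⟩ := (hasEigenvalue_iff_exists T (-1)).1 hev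
        rw [neg_one_smul] at hv
        exact ⟨v, lorentzForm_pos_of_map_eq_neg hT' hv hv0, Or.inr hv⟩
      · exact ⟨v, hQ, Or.inl (hv.apply_eq_smul.trans (one_smul ℝ v))⟩
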